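/- **Setting.** Let $S_g$ be an oriented closed surface of genus $g$ and fix $x_0\in S^1$. Cutting $S^1$ at $x_0$ and projecting $S_g\times[0,1]$ to $S_g$, and then drawing the result in the plane, one represents oriented knots in $S_g\times S^1$ ($g$ arbitrary, up to isotopy and (de)stabilization) by *diagrams with double lines*: oriented plane knot diagrams with classical and virtual crossings and with finitely many double lines on the arcs. A double line marks a point where the knot passes through the level $S_g\times\{x_0\}$; its sign is $+1$ if the knot leaves $S_g\times[0,1]$ at the top and reenters at the bottom, and $-1$ in the opposite case. Diagrams are considered up to the following moves (and planar isotopy): (1)–(3) the three Reidemeister moves; their virtual and mixed versions; (4) a double line moves through a classical crossing, and the over/under information of the crossing is changed (a strand which passes over and then has a positive double line becomes a strand which has a positive double line and then passes under); (4') a double line moves through a virtual crossing; (5) two neighbouring double lines of opposite signs appear or disappear. Two diagrams are *equivalent as knots in $S_g\times S^1$* if they are related by finitely many of these moves. The *crossing sliding move* inserts at a classical crossing, on both of its strands, a double line of sign $\varepsilon$ before the crossing and a double line of sign $-\varepsilon$ after it ($\varepsilon=\pm1$), or removes such double lines. The *degree* of a diagram is the sum of the signs of its double lines. For a classical crossing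 $c$ of a diagram of degree $0$, the *winding parity* of $c$ is the integer obtained by summing the signs of the double lines met when one follows the knot, along its orientation, from the under-passage of $c$ to the over-passage of $c$. Let $\mathcal D^0_{dl}$ be the set of equivalence classes of diagrams of degree $0$. For a diagram $D$ of degree $0$ let $pr_{wp}(D)$ be the diagram obtained by doing the following at each classical crossing $c$, where $i$ is the winding parity of $c$ in $D$: if $i<0$, change the over/under information of $c$; then (in both cases $i\ge 0$ and $i<0$) add, next to the crossing, $|i|$ positive double lines on its incoming under-arc and $|i|$ negative double lines on its outgoing under-arc. Again $pr_{wp}(D)$ has degree $0$. **Theorem.** 1. $pr_{wp}$ induces a well-defined map $\mathcal D^0_{dl}\to\mathcal D^0_{dl}$. 2. If $D_1,D_2$ are diagrams of degree $0$ which are equivalent as knots in $S_g\times S^1$, then $pr_{wp}(D_1)$ and $pr_{wp}(D_2)$ are related by finitely many crossing sliding moves and moves listed above other than move (4). 3. $pr_{wp}\circ pr_{wp}=pr_{wp}$, both for diagrams and for the induced map on $\mathcal D^0_{dl}$. -/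

import Mathlib

/-!  Oriented knot diagrams with double lines (and virtual crossings), the moves generating the
equivalence of knots in `S_g × S¹`, and the winding parity projection.

A diagram is recorded by traversing the oriented knot once from a base point and writing down, in
order, every passage through a crossing (classical or virtual) and every double line.  The genus of
the resulting 4-valent graph is required to be zero, so that the word describes a diagram drawn in
the plane; all crossings of the drawing, including the virtual ones, are recorded.  -/

namespace DoubleLine

/-- How the strand that is being followed passes through a crossing. -/
inductive Passage where
  | over
  | under
  | virt
  deriving DecidableEq

/-- The way the other strand passes through the same crossing. -/
def Passage.dual : Passage → Passage
  | .over => .under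
  | .under => .over
  | .virt => .virt

/-- What is met while following an oriented knot.

* `cross c p s`: a passage through the crossing labelled `c`, of type `p`; `s` is `true` when the
  other strand of the crossing goes from the right to the left of the strand being followed, and
  `false` when it goes from the left to the right.
* `line ε`: a double line of sign `ε`; the sign is `+1` when the knot, followed along its
  orientation, moves up through the level `S_g × {x₀}`, that is, leaves `S_g × [0,1]` at the top
  `S_g × {1}` and reenters at the bottom `S_g × {0}`, and `-1` when it moves down. -/
inductive Token where
  | cross (c : ℕ) (p : Passage) (s : Bool)
  | line (ε : ℤˣ)
  deriving DecidableEq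

/-- A word, to be read cyclically. -/
abbrev Word := List Token

/-- The sign of a double line; crossings have weight `0`. -/
def Token.weight : Token → ℤ
  | .cross _ _ _ => 0
  | .line ε => (ε : ℤ)

/-- The sum of the signs of the double lines in a word. -/
def weight (w : Word) : ℤ := (w.map Token.weight).sum

/-! ### Well-formed planar words -/

/-- The passage recorded by a token, if it is a passage through the crossing `c`. -/
def Token.passage? (c : ℕ) : Token → Option (Passage × Bool)
  | .cross d p s => if d = c then some (p, s) else none
  | .line _ => none

/-- Every crossing is passed exactly twice: once over and once under if it is classical, twice as a
virtual crossing if it is virtual; each of the two strands sees the other one crossing it in the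
opposite sense. -/
def WellFormed (w : Word) : Prop :=
  ∀ c : ℕ, w.filterMap (Token.passage? c) = [] ∨
    ∃ (p : Passage) (s : Bool), w.filterMap (Token.passage? c) = [(p, s), (p.dual, !s)]

/-- The label and the crossing sense of a token, if it is a passage through a crossing. -/
def Token.flat? : Token → Option (ℕ × Bool)
  | .cross c _ s => some (c, s)
  | .line _ => none

/-- The underlying oriented plane curve with double points: double lines and the types of the
crossings are forgotten. -/
def flat (w : Word) : List (ℕ × Bool) := w.filterMap Token.flat?

/-- The directed edges of the 4-valent graph of `f`: the edge `k` joins the `k`-th passage to the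
next one (cyclically), and it can be followed along (`true`) or against (`false`) the orientation
of the knot. -/
abbrev DirEdge (f : List (ℕ × Bool)) := Fin f.length × Bool

/-- The passage at which a directed edge ends. -/
def DirEdge.head {f : List (ℕ × Bool)} (e : DirEdge f) : Fin f.length :=
  if e.2 then finRotate f.length e.1 else e.1

/-- The passage at which a directed edge begins. -/
def DirEdge.tail {f : List (ℕ × Bool)} (e : DirEdge f) : Fin f.length :=
  if e.2 then e.1 else finRotate f.length e.1

/-- `e'` is obtained from `e` by turning left at the crossing where `e` ends: `e'` starts at the
other passage through that crossing, and it follows the orientation of the knot exactly when the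
other strand, seen by someone arriving along `e`, goes from the right to the left. -/
def LeftTurn (f : List (ℕ × Bool)) (e e' : DirEdge f) : Prop :=
  e.head ≠ e'.tail ∧ (f.get e.head).1 = (f.get e'.tail).1 ∧ e'.2 = ((f.get e.head).2 == e.2)

/-- The faces of the 4-valent graph: the orbits of directed edges under turning left. -/
def Face (f : List (ℕ × Bool)) : Type := Quot (LeftTurn f)

/-- The curve lies in the plane (equivalently, in the sphere).  With `n` double points there are
`2 n = f.length` edges, and Euler's formula `V - E + F = 2` reads `2 F = f.length + 4`.
A curve without double points is a circle. -/
def Planar (f : List (ℕ × Bool)) : Prop :=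
  f = [] ∨ 2 * Nat.card (Face f) = f.length + 4

/-- Oriented knot diagrams with double lines (and virtual crossings) in the plane. -/
structure Diagram where
  word : Word
  wellFormed : WellFormed word
  planar : Planar (flat word)

/-- The degree of a diagram: the sum of the signs of all its double lines. -/
def Diagram.degree (D : Diagram) : ℤ := weight D.word

/-! ### Moves -/

/-- Change the over/under information of the crossing `c`. -/
def Token.switch (c : ℕ) : Token → Token
  | .cross d p s => .cross d (if d = c then p.dual else p) s
  | .line ε => .line ε

/-- Rename crossings. -/
def Token.rename (f : ℕ → ℕ) : Token → Token
  | .cross c p s => .cross (f c) p s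
  | .line ε => .line ε

/-- Two consecutive tokens, in one of the two possible orders. -/
def ordered (e : Bool) (t t' : Token) : Word := if e then [t, t'] else [t', t]

/-- The types of crossings allowed in a third Reidemeister move with strands `P`, `Q`, `R`; here
`p₁`, `p₂`, `p₃` say how `P` passes `Q`, how `P` passes `R` and how `Q` passes `R`.
Either all three crossings are classical and the strands lie at three different heights (not
cyclically above one another), or one of the strands has only virtual crossings with the other two,
which may cross in any way. -/
def TriangleTypes (p₁ p₂ p₃ : Passage) : Prop :=
  (p₁ ≠ .virt ∧ p₂ ≠ .virt ∧ p₃ ≠ .virt ∧ ¬ (p₃ = p₁ ∧ p₂ = p₁.dual)) ∨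
  (p₁ = .virt ∧ p₂ = .virt) ∨ (p₁ = .virt ∧ p₃ = .virt) ∨ (p₂ = .virt ∧ p₃ = .virt)

/-- All moves except the move of a double line through a classical crossing.  The first two change
only the way in which one and the same drawing is recorded. -/
inductive BasicMove : Word → Word → Prop
  /-- Change of the base point. -/
  | rotate (u v : Word) : BasicMove (u ++ v) (v ++ u)
  /-- Renaming of the crossings. -/
  | rename (f : ℕ → ℕ) (hf : Function.Injective f) (w : Word) :
      BasicMove w (w.map (Token.rename f))
  /-- First Reidemeister move, classical and virtual. -/
  | first (u v : Word) (c : ℕ) (p : Passage) (s : Bool) :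
      BasicMove (u ++ v) (u ++ [.cross c p s, .cross c p.dual (!s)] ++ v)
  /-- Second Reidemeister move, classical and virtual; the two strands are parallel or antiparallel
  according to `e`. -/
  | second (u v x : Word) (c d : ℕ) (p : Passage) (s e : Bool) :
      BasicMove (u ++ v ++ x)
        (u ++ [.cross c p s, .cross d p (!s)] ++ v ++
          ordered e (.cross c p.dual (!s)) (.cross d p.dual s) ++ x)
  /-- Third Reidemeister move, classical, virtual and mixed.  The strand met first has the crossings
  `a`, `b`, the second one `a`, `c`, the third one `b`, `c`, and each strand passes its two
  crossings in the opposite order afterwards.  The equations between `s₁`, `s₂`, `s₃` say that at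
  the three corners the region between the two edges of the triangle is on the same side, that is,
  that the triangle is a face. -/
  | third (u v x y : Word) (a b c : ℕ) (p₁ p₂ p₃ : Passage) (s₁ s₂ s₃ e₁ e₂ e₃ : Bool)
      (hp : TriangleTypes p₁ p₂ p₃) (h₁₂ : (e₃ ^^ s₁) = (e₂ ^^ s₂)) (h₂₃ : (e₂ ^^ s₂) = (e₁ ^^ s₃)) :
      BasicMove
        (u ++ ordered e₁ (.cross a p₁ s₁) (.cross b p₂ s₂) ++ v ++
          ordered e₂ (.cross a p₁.dual (!s₁)) (.cross c p₃ s₃) ++ x ++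
          ordered e₃ (.cross b p₂.dual (!s₂)) (.cross c p₃.dual (!s₃)) ++ y)
        (u ++ ordered (!e₁) (.cross a p₁ s₁) (.cross b p₂ s₂) ++ v ++
          ordered (!e₂) (.cross a p₁.dual (!s₁)) (.cross c p₃ s₃) ++ x ++
          ordered (!e₃) (.cross b p₂.dual (!s₂)) (.cross c p₃.dual (!s₃)) ++ y)
  /-- A double line moves through a virtual crossing. -/
  | lineVirtual (u v : Word) (c : ℕ) (s : Bool) (ε : ℤˣ) :
      BasicMove (u ++ [.cross c .virt s, .line ε] ++ v) (u ++ [.line ε, .cross c .virt s] ++ v)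
  /-- Two neighbouring double lines of opposite signs appear or disappear. -/
  | lineCancel (u v : Word) (ε : ℤˣ) :
      BasicMove (u ++ [.line ε, .line (-ε)] ++ v) (u ++ v)

/-- A double line moves through a classical crossing, and the crossing is changed.  The
side of a positive double line before it, along the orientation, is at the top level, and the side
after it is at the bottom level; for a negative double line it is the other way round. -/
inductive LineCrossingMove : Word → Word → Prop
  | positive (u v : Word) (c : ℕ) (s : Bool) :
      LineCrossingMove (u ++ [.cross c .over s, .line 1] ++ v)
        (u.map (Token.switch c) ++ [.line 1, .cross c .under s] ++ v.map (Token.switch c))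
  | negative (u v : Word) (c : ℕ) (s : Bool) :
      LineCrossingMove (u ++ [.cross c .under s, .line (-1)] ++ v)
        (u.map (Token.switch c) ++ [.line (-1), .cross c .over s] ++ v.map (Token.switch c))

/-- The crossing sliding move: a classical crossing moves, as a whole, through the level
`S_g × {x₀}`; on both strands a double line of sign `ε` appears before the crossing and one of sign
`-ε` appears after it. -/
inductive SlidingMove : Word → Word → Prop
  | slide (u v x : Word) (c : ℕ) (p : Passage) (hp : p ≠ .virt) (s : Bool) (ε : ℤˣ) :
      SlidingMove (u ++ [.cross c p s] ++ v ++ [.cross c p.dual (!s)] ++ x)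
        (u ++ [.line ε, .cross c p s, .line (-ε)] ++ v ++
          [.line ε, .cross c p.dual (!s), .line (-ε)] ++ x)

/-- Equivalence of diagrams as knots in `S_g × S¹`: they are related by finitely many moves. -/
def Equivalent : Diagram → Diagram → Prop :=
  Relation.EqvGen fun D D' => BasicMove D.word D'.word ∨ LineCrossingMove D.word D'.word

/-- Equivalence of diagrams up to the crossing sliding move and all moves except the move of
a double line through a classical crossing. -/
def SlidingEquivalent : Diagram → Diagram → Prop :=
  Relation.EqvGen fun D D' => BasicMove D.word D'.word ∨ SlidingMove D.word D'.word

/-! ### Winding parity and the projection -/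

/-- The token is not the passage of type `p` through the crossing `c`. -/
def Token.isNot (c : ℕ) (p : Passage) : Token → Bool
  | .cross d q _ => !(decide (d = c) && decide (q = p))
  | .line _ => true

/-- The half `γ_c` of the knot at the crossing `c`: from the under-passage of `c`, along the
orientation, to its over-passage. -/
def half (w : Word) (c : ℕ) : Word :=
  (w.dropWhile (Token.isNot c .under) ++ w.takeWhile (Token.isNot c .under)).takeWhile
    (Token.isNot c .over)

/-- The winding parity of a classical crossing `c` (of a diagram of degree `0`, where it is an
integer): the sum of the signs of the double lines on `γ_c`. -/
def windingParity (w : Word) (c : ℕ) : ℤ := weight (half w c)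

/-- The passage through `c` after projection, if `c` has winding parity `i`: the crossing is changed
if `i < 0`; afterwards, `|i|` positive double lines are put on the incoming under-arc and `|i|`
negative ones on the outgoing under-arc. -/
def projectPassage (i : ℤ) (c : ℕ) (p : Passage) (s : Bool) : Word :=
  let q := if i < 0 then p.dual else p
  if q = .under then
    List.replicate i.natAbs (.line 1) ++ [.cross c q s] ++ List.replicate i.natAbs (.line (-1))
  else [.cross c q s]

/-- Projection of a token of the word `w`. -/
def projectToken (w : Word) : Token → Word
  | .cross c p s => projectPassage (windingParity w c) c p s
  | .line ε => [.line ε]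

/-- The winding parity projection on words. -/
def projectWord (w : Word) : Word := w.flatMap (projectToken w)

theorem filterMap_replicate_line {α : Type} (g : Token → Option α) (ε : ℤˣ)
    (h : g (.line ε) = none) (n : ℕ) : (List.replicate n (Token.line ε)).filterMap g = [] := by
  simp [h]

theorem flat_projectWord (w : Word) : flat (projectWord w) = flat w := by
  have key : ∀ t, (projectToken w t).filterMap Token.flat? = [t].filterMap Token.flat? := by
    intro t
    cases t with
    | line ε => rfl
    | cross c p s =>
      simp only [projectToken, projectPassage]
      have h := filterMap_replicate_line Token.flat? (ε := 1) rfl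
      have h' := filterMap_replicate_line Token.flat? (ε := -1) rfl
      split_ifs <;> simp [h, h', Token.flat?]
  have gen : ∀ v : Word, (v.flatMap (projectToken w)).filterMap Token.flat? =
      v.filterMap Token.flat? := by
    intro v
    induction v with
    | nil => rfl
    | cons t v ih =>
      rw [List.flatMap_cons, List.filterMap_append, ih, key t, ← List.filterMap_append]
      rfl
  exact gen w

theorem dual_dual (p : Passage) : p.dual.dual = p := by cases p <;> rfl

theorem wellFormed_projectWord (w : Word) (hw : WellFormed w) : WellFormed (projectWord w) := by
  intro c
  set g : Passage → Passage := fun p => if windingParity w c < 0 then p.dual else p with hg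
  have key : ∀ t, (projectToken w t).filterMap (Token.passage? c) =
      ([t].filterMap (Token.passage? c)).map (fun q => (g q.1, q.2)) := by
    intro t
    cases t with
    | line ε => rfl
    | cross d p s =>
      simp only [projectToken, projectPassage]
      have h := filterMap_replicate_line (Token.passage? c) (ε := 1) rfl
      have h' := filterMap_replicate_line (Token.passage? c) (ε := -1) rfl
      by_cases hd : d = c
      · subst hd
        split_ifs <;> simp [Token.passage?, *]
      · split_ifs <;> simp [h, h', Token.passage?, hd]
  have gen : ∀ v : Word, (v.flatMap (projectToken w)).filterMap (Token.passage? c) =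
      (v.filterMap (Token.passage? c)).map (fun q => (g q.1, q.2)) := by
    intro v
    induction v with
    | nil => rfl
    | cons t v ih =>
      rw [List.flatMap_cons, List.filterMap_append, ih, key t, ← List.map_append,
        ← List.filterMap_append]
      rfl
  have h := gen w
  rcases hw c with h0 | ⟨p, s, h1⟩
  · left
    rw [projectWord, h, h0]; rfl
  · right
    refine ⟨g p, s, ?_⟩
    rw [projectWord, h, h1]
    simp only [List.map_cons, List.map_nil, hg]
    split_ifs <;> rfl

theorem weight_projectWord (w : Word) : weight (projectWord w) = weight w := by
  have key : ∀ t, weight (projectToken w t) = t.weight := by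
    intro t
    cases t with
    | line ε => simp [projectToken, weight]
    | cross c p s =>
      simp only [projectToken, projectPassage]
      split_ifs <;> simp [weight, Token.weight]
  have gen : ∀ v : Word, weight (v.flatMap (projectToken w)) = weight v := by
    intro v
    induction v with
    | nil => rfl
    | cons t v ih =>
      have h : weight (projectToken w t ++ v.flatMap (projectToken w)) =
          weight (projectToken w t) + weight (v.flatMap (projectToken w)) := by
        simp [weight]
      rw [List.flatMap_cons, h, ih, key t]
      simp [weight]
  exact gen w

/-- Diagrams of degree `0`. -/
abbrev DiagramZero := {D : Diagram // D.degree = 0}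

/-- The winding parity projection on diagrams of degree `0`. -/
def prWP (D : DiagramZero) : DiagramZero :=
  ⟨⟨projectWord D.1.word, wellFormed_projectWord _ D.1.wellFormed,
      (flat_projectWord D.1.word).symm ▸ D.1.planar⟩,
    (weight_projectWord D.1.word).trans D.2⟩

/-- Equivalence as knots in `S_g × S¹`, on diagrams of degree `0`. -/
def setoidZero : Setoid DiagramZero :=
  (Relation.EqvGen.setoid fun D D' : Diagram =>
    BasicMove D.word D'.word ∨ LineCrossingMove D.word D'.word).comap Subtype.val

/-- The set of equivalence classes of diagrams of degree `0`. -/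
abbrev ClassZero : Type := Quotient setoidZero

/-- The equivalence class of a diagram of degree `0`. -/
def classOf (D : DiagramZero) : ClassZero := Quotient.mk setoidZero D

end DoubleLine

/-!
A knot of degree `0` in `S_g × S¹` lifts to `S_g × ℝ`.  On a diagram, the lift is visible through the
*level* of a passage, the sum of the signs of the double lines met before it: in the lift the strands
of a crossing are ordered by their levels first, and strands of the same level are ordered as in the
diagram.  The winding parity of a crossing is the level of its over-passage minus the level of its
under-passage (`WellFormed.windingParity_eq`), so switching the crossings of negative winding parity
and forgetting the double lines gives the diagram `Diagram.lift` of the projection of the lift.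

Two facts about the lift give part 2.

* Up to moves of double lines, virtual moves included, and crossing sliding moves, the winding parity
  projection of a diagram is its lift (`projectWord_lineEquiv`).  A sliding move adds the same number
  of double lines around both passages of a crossing, so only the difference of these numbers
  matters, and it is prescribed by the winding parity (`decorate_slide`).  One may therefore put
  `-ℓ` double lines before every classical passage of level `ℓ`, and `ℓ` after it.  All crossings are
  then at level `0`, and the double lines between two consecutive ones cancel (`decorate_descent`).
* If two diagrams are related by a move, then their lifts are equal or related by one basic move
  (`lift_move`).  Moving a double line through a classical crossing does not change the lift
  (`LineCrossingMove.lift_eq`), and the strands of a third Reidemeister move remain at three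
  different heights, because levels are linearly ordered (`TriangleTypes.twist`).

A crossing sliding move is the composition of two moves of a double line through the crossing, one
for each strand (`SlidingMove.eqvGen`), so part 2 implies that the projection is well defined on
classes.  Finally, the double lines added by the projection make all winding parities vanish
(`windingParity_projectWord`), and a second projection changes nothing.

Planarity of the intermediate diagrams is automatic, since double lines and the over/under
information do not affect the underlying plane curve (`isDiagram_iff`).
-/

namespace DoubleLine

/-! ### Words without double lines -/

/-- The passage type `p`, changed if `b` holds. -/
def twist (b : Bool) (p : Passage) : Passage := if b then p.dual else p

/-- Remove a double line; switch a crossing `c` with `g c`. -/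
def Token.erase? (g : ℕ → Bool) : Token → Option Token
  | .cross c p s => some (.cross c (twist (g c) p) s)
  | .line _ => none

/-- Remove all double lines from a word and switch the crossings `c` with `g c`. -/
def erase (g : ℕ → Bool) (w : Word) : Word := w.filterMap (Token.erase? g)

/-- The crossings of a word, without the double lines. -/
abbrev crossings (w : Word) : Word := erase (fun _ => false) w

@[simp] theorem erase_nil (g : ℕ → Bool) : erase g [] = [] := rfl

@[simp] theorem erase_append (g : ℕ → Bool) (u v : Word) :
    erase g (u ++ v) = erase g u ++ erase g v := List.filterMap_append ..

@[simp] theorem erase_cross_cons (g : ℕ → Bool) (c : ℕ) (p : Passage) (s : Bool) (v : Word) :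
    erase g (.cross c p s :: v) = .cross c (twist (g c) p) s :: erase g v := rfl

@[simp] theorem erase_line_cons (g : ℕ → Bool) (ε : ℤˣ) (v : Word) :
    erase g (.line ε :: v) = erase g v := rfl

@[simp] theorem twist_false (p : Passage) : twist false p = p := rfl

@[simp] theorem twist_true (p : Passage) : twist true p = p.dual := rfl

@[simp] theorem twist_virt (b : Bool) : twist b .virt = .virt := by cases b <;> rfl

theorem twist_dual (b : Bool) (p : Passage) : twist b p.dual = (twist b p).dual := by
  cases b <;> rfl

@[simp] theorem twist_eq_virt {b : Bool} {p : Passage} : twist b p = .virt ↔ p = .virt := by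
  cases b <;> cases p <;> simp [Passage.dual]

@[simp] theorem twist_twist (b : Bool) (p : Passage) : twist b (twist b p) = p := by
  cases b <;> cases p <;> rfl

@[simp] theorem dual_eq_virt {p : Passage} : p.dual = .virt ↔ p = .virt := by
  cases p <;> simp [Passage.dual]

theorem erase_congr {g g' : ℕ → Bool} {w : Word}
    (h : ∀ c p s, Token.cross c p s ∈ w → p ≠ .virt → g c = g' c) : erase g w = erase g' w := by
  apply List.filterMap_congr
  rintro (⟨c, p, s⟩ | ε) ht
  · by_cases hp : p = .virt
    · simp [Token.erase?, hp]
    · simp [Token.erase?, h c p s ht hp]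
  · rfl

theorem mem_erase (g : ℕ → Bool) {w : Word} {c : ℕ} {p : Passage} {s : Bool}
    (h : .cross c p s ∈ w) : .cross c (twist (g c) p) s ∈ erase g w :=
  List.mem_filterMap.2 ⟨_, h, rfl⟩

theorem mem_of_mem_erase {g : ℕ → Bool} {w : Word} {c : ℕ} {p : Passage} {s : Bool}
    (h : .cross c p s ∈ erase g w) : .cross c (twist (g c) p) s ∈ w := by
  obtain ⟨⟨d, q, r⟩ | ε, h, h'⟩ := List.mem_filterMap.1 h
  · cases h'
    simpa using h
  · cases h'

theorem flat_erase (g : ℕ → Bool) (w : Word) : flat (erase g w) = flat w := by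
  simp only [flat, erase, List.filterMap_filterMap]
  apply List.filterMap_congr
  rintro (_ | _) _ <;> rfl

theorem passages_erase (g : ℕ → Bool) (w : Word) (c : ℕ) :
    (erase g w).filterMap (Token.passage? c) =
      (w.filterMap (Token.passage? c)).map fun q => (twist (g c) q.1, q.2) := by
  simp only [erase, List.filterMap_filterMap, List.map_filterMap]
  apply List.filterMap_congr
  rintro (⟨d, p, s⟩ | _) _
  · by_cases h : d = c
    · subst h; simp [Token.erase?, Token.passage?]
    · simp [Token.erase?, Token.passage?, h]
  · rfl

theorem erase_erase (g : ℕ → Bool) (w : Word) : erase g (erase g w) = crossings w := by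
  simp only [erase, List.filterMap_filterMap]
  apply List.filterMap_congr
  rintro (_ | _) _ <;> simp [Token.erase?]

theorem WellFormed.erase {w : Word} (h : WellFormed w) (g : ℕ → Bool) :
    WellFormed (erase g w) := by
  intro c
  rw [passages_erase]
  rcases h c with h | ⟨p, s, h⟩
  · exact .inl (by rw [h]; rfl)
  · exact .inr ⟨twist (g c) p, s, by rw [h]; simp [twist_dual]⟩

theorem wellFormed_crossings {w : Word} : WellFormed (crossings w) ↔ WellFormed w := by
  refine ⟨fun h c => ?_, fun h => h.erase _⟩
  have h := h c
  rw [passages_erase] at h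
  simpa using h

theorem wellFormed_erase {g : ℕ → Bool} {w : Word} : WellFormed (erase g w) ↔ WellFormed w :=
  ⟨fun h => wellFormed_crossings.1 (erase_erase g w ▸ h.erase g), fun h => h.erase g⟩

/-- The word describes a plane diagram. -/
def IsDiagram (w : Word) : Prop := WellFormed w ∧ Planar (flat w)

theorem Diagram.isDiagram (D : Diagram) : IsDiagram D.word := ⟨D.wellFormed, D.planar⟩

theorem isDiagram_erase {g : ℕ → Bool} {w : Word} : IsDiagram (erase g w) ↔ IsDiagram w := by
  rw [IsDiagram, IsDiagram, wellFormed_erase, flat_erase]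

/-- Whether a word describes a plane diagram depends neither on the double lines nor on the
over/under information. -/
theorem isDiagram_iff {w w' : Word} (g : ℕ → Bool) (h : crossings w' = erase g w) :
    IsDiagram w ↔ IsDiagram w' := by
  rw [← isDiagram_erase (g := g), ← h, isDiagram_erase]

/-- A chain of relations between words, along which the property of being a plane diagram is
constant, is a chain of relations between diagrams. -/
theorem eqvGen_diagram {r : Word → Word → Prop} {R : Diagram → Diagram → Prop}
    (hr : ∀ w w', r w w' → (IsDiagram w ↔ IsDiagram w'))
    (hR : ∀ D D' : Diagram, r D.word D'.word → R D D') {w w' : Word}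
    (h : Relation.EqvGen r w w') :
    (IsDiagram w ↔ IsDiagram w') ∧
      ∀ D D' : Diagram, D.word = w → D'.word = w' → Relation.EqvGen R D D' := by
  induction h with
  | rel w w' h =>
    refine ⟨hr _ _ h, ?_⟩
    rintro D D' rfl rfl
    exact .rel _ _ (hR _ _ h)
  | refl w =>
    refine ⟨Iff.rfl, ?_⟩
    rintro ⟨w₁, _, _⟩ ⟨w₂, _, _⟩ rfl h
    obtain rfl : w₂ = w₁ := h
    exact .refl _
  | symm w w' _ ih => exact ⟨ih.1.symm, fun D D' h h' => .symm _ _ (ih.2 D' D h' h)⟩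
  | trans w₁ w₂ w₃ _ _ ih ih' =>
    refine ⟨ih.1.trans ih'.1, fun D D' h h' => ?_⟩
    have h₂ : IsDiagram w₂ := ih.1.1 (h ▸ D.isDiagram)
    exact .trans _ ⟨w₂, h₂.1, h₂.2⟩ _ (ih.2 _ _ h rfl) (ih'.2 _ _ rfl h')

/-! ### Occurrences of crossings in a word -/

@[simp] theorem weight_nil : weight [] = 0 := rfl

@[simp] theorem weight_append (u v : Word) : weight (u ++ v) = weight u + weight v := by
  simp [weight]

@[simp] theorem weight_cross_cons (c : ℕ) (p : Passage) (s : Bool) (v : Word) :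
    weight (.cross c p s :: v) = weight v := by
  simp [weight, Token.weight]

@[simp] theorem weight_line_cons (ε : ℤˣ) (v : Word) :
    weight (.line ε :: v) = ε + weight v := by
  simp [weight, Token.weight]

/-- The number of passages through the crossing `c`. -/
def multiplicity (c : ℕ) (w : Word) : ℕ := (w.filterMap (Token.passage? c)).length

@[simp] theorem multiplicity_nil (c : ℕ) : multiplicity c [] = 0 := rfl

@[simp] theorem multiplicity_append (c : ℕ) (u v : Word) :
    multiplicity c (u ++ v) = multiplicity c u + multiplicity c v := by
  simp [multiplicity]

@[simp] theorem multiplicity_line_cons (c : ℕ) (ε : ℤˣ) (v : Word) :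
    multiplicity c (.line ε :: v) = multiplicity c v := rfl

@[simp] theorem multiplicity_cross_cons (c d : ℕ) (p : Passage) (s : Bool) (v : Word) :
    multiplicity c (.cross d p s :: v) = (if d = c then 1 else 0) + multiplicity c v := by
  by_cases h : d = c <;> simp [multiplicity, Token.passage?, h]; omega

theorem multiplicity_pos {c : ℕ} {p : Passage} {s : Bool} {w : Word} (h : .cross c p s ∈ w) :
    0 < multiplicity c w := by
  obtain ⟨u, v, rfl⟩ := List.append_of_mem h
  simp

theorem WellFormed.multiplicity_le {w : Word} (h : WellFormed w) (c : ℕ) :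
    multiplicity c w ≤ 2 := by
  rcases h c with h | ⟨p, s, h⟩ <;> simp [multiplicity, h]

theorem mem_passages {c : ℕ} {p : Passage} {s : Bool} {w : Word} :
    (p, s) ∈ w.filterMap (Token.passage? c) ↔ .cross c p s ∈ w := by
  rw [List.mem_filterMap]
  constructor
  · rintro ⟨⟨d, q, r⟩ | _, h, h'⟩
    · by_cases hd : d = c <;> simp [Token.passage?, hd] at h'
      rw [← hd, ← h'.1, ← h'.2]; exact h
    · cases h'
  · exact fun h => ⟨_, h, by simp [Token.passage?]⟩

/-- The passage of type `p` through `c` does not occur in `w`. -/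
def Avoids (w : Word) (c : ℕ) (p : Passage) : Prop := w.all (Token.isNot c p) = true

instance (w : Word) (c : ℕ) (p : Passage) : Decidable (Avoids w c p) :=
  inferInstanceAs (Decidable (_ = true))

theorem avoids_iff {w : Word} {c : ℕ} {p : Passage} :
    Avoids w c p ↔ ∀ s, Token.cross c p s ∉ w := by
  rw [Avoids, List.all_eq_true]
  constructor
  · intro h s hs
    simpa [Token.isNot] using h _ hs
  · rintro h (⟨d, q, s⟩ | _) ht
    · by_contra hc
      simp [Token.isNot] at hc
      exact h s (hc.1 ▸ hc.2 ▸ ht)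
    · rfl

theorem avoids_of_multiplicity {w : Word} {c : ℕ} (h : multiplicity c w = 0) (p : Passage) :
    Avoids w c p :=
  avoids_iff.2 fun _ hs => absurd (multiplicity_pos hs) (by omega)

/-- In a diagram, a classical crossing is passed over only once and under only once. -/
theorem WellFormed.avoids {u v : Word} {c : ℕ} {p : Passage} {s : Bool}
    (h : WellFormed (u ++ .cross c p s :: v)) (hp : p ≠ .virt) :
    Avoids u c p ∧ Avoids v c p := by
  have key : ∀ r, .cross c p r ∉ u ∧ .cross c p r ∉ v := by
    intro r
    rw [← mem_passages, ← mem_passages (w := v)]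
    rcases h c with h | ⟨q, t, h⟩
    · simp [Token.passage?] at h
    · simp only [List.filterMap_append, List.filterMap_cons, Token.passage?, if_true] at h
      have hq : q ≠ q.dual ∨ q = .virt := by cases q <;> simp [Passage.dual]
      rcases hu : u.filterMap (Token.passage? c) with _ | ⟨a, _ | ⟨b, l⟩⟩
      · simp only [hu, List.nil_append, List.cons.injEq, Prod.mk.injEq] at h
        simp only [h.2, List.mem_singleton, Prod.mk.injEq]
        grind
      · simp [hu] at h
        grind
      · simp [hu] at h
  exact ⟨avoids_iff.2 fun r => (key r).1, avoids_iff.2 fun r => (key r).2⟩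

/-- A classical crossing that occurs in a diagram is passed over and under. -/
theorem WellFormed.exists_mem {w : Word} (h : WellFormed w) {c : ℕ} {p : Passage} {s : Bool}
    (hs : .cross c p s ∈ w) : ∃ r, .cross c p.dual r ∈ w := by
  simp only [← mem_passages] at hs ⊢
  rcases h c with h | ⟨q, t, h⟩ <;> rw [h] at hs ⊢ <;> simp at hs
  rcases hs with ⟨rfl, _⟩ | ⟨rfl, _⟩
  · exact ⟨!t, by simp⟩
  · exact ⟨t, by simp [dual_dual]⟩

/-! ### Levels -/

/-- The level of the passage of type `p` through `c`: the sum of the signs of the double lines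
between the base point and this passage. -/
def level (w : Word) (c : ℕ) (p : Passage) : ℤ := weight (w.takeWhile (Token.isNot c p))

theorem takeWhile_append {α : Type*} (f : α → Bool) (u v : List α) :
    (u ++ v).takeWhile f = if u.all f then u ++ v.takeWhile f else u.takeWhile f := by
  induction u with
  | nil => simp
  | cons a u ih => by_cases h : f a <;> simp [h, ih]; split_ifs <;> rfl

@[simp] theorem level_append (u v : Word) (c : ℕ) (p : Passage) :
    level (u ++ v) c p = if Avoids u c p then weight u + level v c p else level u c p := by
  unfold level
  by_cases h : Avoids u c p
  · rw [takeWhile_append, if_pos (show u.all (Token.isNot c p) = true from h), if_pos h,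
      weight_append]
  · rw [takeWhile_append, if_neg (show ¬ u.all (Token.isNot c p) = true from h), if_neg h]

@[simp] theorem level_nil (c : ℕ) (p : Passage) : level [] c p = 0 := rfl

@[simp] theorem level_line_cons (ε : ℤˣ) (v : Word) (c : ℕ) (p : Passage) :
    level (.line ε :: v) c p = ε + level v c p := by
  rw [level, List.takeWhile_cons_of_pos rfl, weight_line_cons, level]

@[simp] theorem level_cross_cons (d : ℕ) (q : Passage) (s : Bool) (v : Word) (c : ℕ)
    (p : Passage) :
    level (.cross d q s :: v) c p = if d = c ∧ q = p then 0 else level v c p := by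
  by_cases h : d = c ∧ q = p
  · simp [level, Token.isNot, h]
  · have h' : ¬ d = c ∨ ¬ q = p := by tauto
    simp only [h, if_false]
    rcases h' with h' | h' <;> simp [level, Token.isNot, h']

@[simp] theorem avoids_nil (c : ℕ) (p : Passage) : Avoids [] c p := by
  simp [Avoids]

@[simp] theorem avoids_line_cons (ε : ℤˣ) (v : Word) (c : ℕ) (p : Passage) :
    Avoids (.line ε :: v) c p ↔ Avoids v c p := by
  simp [Avoids, Token.isNot]

@[simp] theorem avoids_cross_cons (d : ℕ) (q : Passage) (s : Bool) (v : Word) (c : ℕ)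
    (p : Passage) : Avoids (.cross d q s :: v) c p ↔ ¬ (d = c ∧ q = p) ∧ Avoids v c p := by
  by_cases hd : d = c <;> simp [Avoids, Token.isNot, hd]

@[simp] theorem avoids_append (u v : Word) (c : ℕ) (p : Passage) :
    Avoids (u ++ v) c p ↔ Avoids u c p ∧ Avoids v c p := by
  simp [Avoids]

/-- The half of the knot from the under-passage to the over-passage changes the level by the
winding parity. -/
theorem windingParity_eq {w : Word} (hw : WellFormed w) (h₀ : weight w = 0) {c : ℕ} {s s' : Bool}
    (ho : .cross c .over s ∈ w) (hu : .cross c .under s' ∈ w) :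
    windingParity w c = level w c .over - level w c .under := by
  obtain ⟨u, v, rfl⟩ := List.append_of_mem hu
  have ha := hw.avoids (by simp)
  have e₁ : (u ++ .cross c .under s' :: v).dropWhile (Token.isNot c .under) =
      .cross c .under s' :: v := by
    rw [List.dropWhile_append_of_pos (fun t ht => List.all_eq_true.1 ha.1 t ht)]
    simp [Token.isNot]
  have e₂ : (u ++ .cross c .under s' :: v).takeWhile (Token.isNot c .under) = u := by
    rw [takeWhile_append, if_pos (show u.all _ = true from ha.1)]
    simp [Token.isNot]
  have e₃ : windingParity (u ++ .cross c .under s' :: v) c =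
      level (.cross c .under s' :: v ++ u) c .over := by
    rw [windingParity, half, e₁, e₂, level]
  rw [e₃]
  simp only [level_append, level_cross_cons, avoids_cross_cons, weight_append,
    weight_cross_cons, if_pos ha.1] at h₀ ⊢
  by_cases h : Avoids u c .over
  · by_cases h' : Avoids v c .over
    · rw [avoids_iff] at h h'
      simp at ho
      rcases ho with ho | ho
      · exact absurd ho (h _)
      · exact absurd ho (h' _)
    · simp [h, h']
  · have h' : Avoids v c .over := by
      obtain ⟨r, hr⟩ : ∃ r, .cross c .over r ∈ u := by
        simpa only [avoids_iff, not_forall, not_not] using h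
      obtain ⟨x, y, rfl⟩ := List.append_of_mem hr
      rw [List.append_assoc, List.cons_append] at hw
      have h := (hw.avoids (by simp)).2
      simp only [avoids_append, avoids_cross_cons] at h
      exact h.2.2
    simp [h, h']
    omega

/-! ### Lifting the knot -/

/-- The over-passage of `c` lies at a lower level than its under-passage, so that the two strands
are in the opposite order in the lift of the knot to `S_g × ℝ`. -/
def reversed (w : Word) (c : ℕ) : Bool := decide (level w c .over < level w c .under)

/-- The diagram without double lines of the lift to `S_g × ℝ` of a knot of degree `0`. -/
def lift (w : Word) : Word := erase (reversed w) w

/-- The diagram of the lift to `S_g × ℝ`. -/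
def Diagram.lift (D : Diagram) : Diagram :=
  have h : IsDiagram (DoubleLine.lift D.word) := isDiagram_erase.2 D.isDiagram
  ⟨DoubleLine.lift D.word, h.1, h.2⟩

theorem reversed_congr {w w' : Word} {c d : ℕ} (k : ℤ)
    (h : ∀ p, p ≠ .virt → level w' d p = level w c p + k) :
    reversed w' d = reversed w c := by
  simp only [reversed, h .over (by simp), h .under (by simp)]
  exact decide_eq_decide.2 (by omega)

theorem level_rename {f : ℕ → ℕ} (hf : Function.Injective f) (w : Word) (c : ℕ) (p : Passage) :
    level (w.map (Token.rename f)) (f c) p = level w c p := by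
  induction w with
  | nil => rfl
  | cons t w ih =>
    rcases t with ⟨d, q, s⟩ | ε
    · simp [Token.rename, hf.eq_iff, ih]
    · simp [Token.rename, ih]

theorem lift_rename {f : ℕ → ℕ} (hf : Function.Injective f) (w : Word) :
    lift (w.map (Token.rename f)) = (lift w).map (Token.rename f) := by
  have h : ∀ c, reversed (w.map (Token.rename f)) (f c) = reversed w c := fun c =>
    reversed_congr 0 fun p _ => by rw [level_rename hf, add_zero]
  simp only [lift, erase, List.filterMap_map, List.map_filterMap]
  apply List.filterMap_congr
  rintro (⟨c, p, s⟩ | ε) _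
  · simp [Token.rename, Token.erase?, h]
  · rfl

theorem lift_rotate {u v : Word} (hw : WellFormed (u ++ v)) (h₀ : weight (u ++ v) = 0) :
    lift (v ++ u) = erase (reversed (u ++ v)) v ++ erase (reversed (u ++ v)) u := by
  rw [lift, ← erase_append]
  apply erase_congr
  intro c p s hc hp
  -- Reading `v` first raises all levels by `weight v`, because `weight v = -weight u`.
  refine reversed_congr (weight v) fun q hq => ?_
  have hm : ∃ r, .cross c q r ∈ u ++ v := by
    have hc' : .cross c p s ∈ u ++ v := by simpa [or_comm] using hc
    obtain ⟨r, hr⟩ := hw.exists_mem hc'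
    by_cases hpq : q = p
    · exact ⟨s, hpq ▸ hc'⟩
    · have : q = p.dual := by revert hp hq hpq; cases p <;> cases q <;> simp [Passage.dual]
      exact ⟨r, this ▸ hr⟩
  obtain ⟨r, hr⟩ := hm
  rw [weight_append] at h₀
  rcases List.mem_append.1 hr with hr | hr
  · have hu : ¬ Avoids u c q := by rw [avoids_iff]; exact fun h => h r hr
    have hv : Avoids v c q := by
      obtain ⟨x, y, rfl⟩ := List.append_of_mem hr
      rw [List.append_assoc, List.cons_append] at hw
      have h := (hw.avoids hq).2
      rw [avoids_append] at h
      exact h.2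
    simp [hu, hv, add_comm]
  · have hv : ¬ Avoids v c q := by rw [avoids_iff]; exact fun h => h r hr
    have hu : Avoids u c q := by
      obtain ⟨x, y, rfl⟩ := List.append_of_mem hr
      rw [← List.append_assoc] at hw
      have h := (hw.avoids hq).1
      rw [avoids_append] at h
      exact h.1
    simp [hu, hv]
    omega

/-- In the lift the three strands of a third Reidemeister move stay at three different heights:
they are ordered by the levels `i`, `j`, `k` first, and within a level as before. -/
theorem TriangleTypes.twist {p₁ p₂ p₃ : Passage} (h : TriangleTypes p₁ p₂ p₃) {i j k : ℤ}
    {b₁ b₂ b₃ : Bool}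
    (h₁ : p₁ ≠ .virt → b₁ = if p₁ = .over then decide (i < j) else decide (j < i))
    (h₂ : p₂ ≠ .virt → b₂ = if p₂ = .over then decide (i < k) else decide (k < i))
    (h₃ : p₃ ≠ .virt → b₃ = if p₃ = .over then decide (j < k) else decide (k < j)) :
    TriangleTypes (DoubleLine.twist b₁ p₁) (DoubleLine.twist b₂ p₂) (DoubleLine.twist b₃ p₃) := by
  rcases h with ⟨n₁, n₂, n₃, h⟩ | h | h | h
  · refine .inl ⟨by simpa, by simpa, by simpa, ?_⟩
    rw [h₁ n₁, h₂ n₂, h₃ n₃]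
    simp only [DoubleLine.twist]
    cases p₁ <;> cases p₂ <;> cases p₃ <;>
      simp [Passage.dual] at n₁ n₂ n₃ h ⊢ <;> split_ifs <;> simp <;> omega
  · exact .inr (.inl (by simpa using h))
  · exact .inr (.inr (.inl (by simpa using h)))
  · exact .inr (.inr (.inr (by simpa using h)))

theorem reversed_eq_of_level {w : Word} {c : ℕ} {p : Passage} (hp : p ≠ .virt) {i j : ℤ}
    (hi : level w c p = i) (hj : level w c p.dual = j) :
    reversed w c = if p = .over then decide (i < j) else decide (j < i) := by
  subst hi hj
  cases p <;> simp [reversed, Passage.dual] at hp ⊢ <;> exact decide_eq_decide.2 Iff.rfl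

theorem erase_ordered (g : ℕ → Bool) (e : Bool) (c d : ℕ) (p q : Passage) (s t : Bool) :
    erase g (ordered e (.cross c p s) (.cross d q t)) =
      ordered e (.cross c (twist (g c) p) s) (.cross d (twist (g d) q) t) := by
  cases e <;> rfl

@[simp] theorem weight_ordered (e : Bool) (c d : ℕ) (p q : Passage) (s t : Bool) :
    weight (ordered e (.cross c p s) (.cross d q t)) = 0 := by
  cases e <;> simp [ordered]

@[simp] theorem multiplicity_ordered (e : Bool) (c d x : ℕ) (p q : Passage) (s t : Bool) :
    multiplicity x (ordered e (.cross c p s) (.cross d q t)) =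
      (if c = x then 1 else 0) + if d = x then 1 else 0 := by
  cases e <;> simp [ordered, add_comm]

@[simp] theorem avoids_ordered (e : Bool) (c d x : ℕ) (p q r : Passage) (s t : Bool) :
    Avoids (ordered e (.cross c p s) (.cross d q t)) x r ↔
      ¬ (c = x ∧ p = r) ∧ ¬ (d = x ∧ q = r) := by
  cases e <;> simp [ordered, and_comm]

@[simp] theorem level_ordered (e : Bool) (c d x : ℕ) (p q r : Passage) (s t : Bool) :
    level (ordered e (.cross c p s) (.cross d q t)) x r = 0 := by
  cases e <;> simp [ordered]

theorem lift_first {u v : Word} {c : ℕ} {p : Passage} {s : Bool}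
    (hw : WellFormed (u ++ [.cross c p s, .cross c p.dual (!s)] ++ v)) :
    BasicMove (lift (u ++ v)) (lift (u ++ [.cross c p s, .cross c p.dual (!s)] ++ v)) := by
  set w := u ++ [.cross c p s, .cross c p.dual (!s)] ++ v with hw_def
  have hm := hw.multiplicity_le c
  simp [hw_def] at hm
  have e : lift (u ++ v) = erase (reversed w) u ++ erase (reversed w) v := by
    rw [lift, ← erase_append]
    refine erase_congr fun d q r hd _ => reversed_congr 0 fun p' _ => ?_
    have hcd : c ≠ d := by
      rintro rfl
      have := multiplicity_pos hd
      simp at this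
      omega
    simp [hw_def, hcd]
  rw [e, lift]
  generalize reversed w = g
  rw [hw_def]
  simp only [erase_append, erase_cross_cons, erase_nil, twist_dual]
  exact .first ..

theorem lift_second {u v x : Word} {c d : ℕ} {p : Passage} {s e : Bool}
    (hw : WellFormed (u ++ [.cross c p s, .cross d p (!s)] ++ v ++
      ordered e (.cross c p.dual (!s)) (.cross d p.dual s) ++ x)) :
    BasicMove (lift (u ++ v ++ x)) (lift (u ++ [.cross c p s, .cross d p (!s)] ++ v ++
      ordered e (.cross c p.dual (!s)) (.cross d p.dual s) ++ x)) := by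
  set w := u ++ [.cross c p s, .cross d p (!s)] ++ v ++
      ordered e (.cross c p.dual (!s)) (.cross d p.dual s) ++ x with hw_def
  have hc := hw.multiplicity_le c
  have hd := hw.multiplicity_le d
  simp [hw_def] at hc hd
  have hcd : c ≠ d := by
    rintro rfl
    simp at hc
    omega
  simp [hcd, hcd.symm] at hc hd
  have e₁ : lift (u ++ v ++ x) =
      erase (reversed w) u ++ erase (reversed w) v ++ erase (reversed w) x := by
    rw [lift, ← erase_append, ← erase_append]
    refine erase_congr fun a q r ha _ => reversed_congr 0 fun p' _ => ?_
    have h := multiplicity_pos ha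
    simp only [multiplicity_append] at h
    have hca : c ≠ a := by rintro rfl; omega
    have hda : d ≠ a := by rintro rfl; omega
    simp [hw_def, hca, hda]
  have e₂ : twist (reversed w c) p = twist (reversed w d) p := by
    by_cases hp : p = .virt
    · simp [hp]
    · have hp' : p ≠ p.dual := by revert hp; cases p <;> simp [Passage.dual]
      have ac := fun y h q => avoids_of_multiplicity (w := y) (c := c) h q
      have ad := fun y h q => avoids_of_multiplicity (w := y) (c := d) h q
      have key : reversed w c = reversed w d := reversed_congr 0 fun q hq => by
        have hq' : q = p ∨ q = p.dual := by
          revert hp hq; cases p <;> cases q <;> simp [Passage.dual]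
        rcases hq' with rfl | rfl
        · simp [hw_def, ac u (by omega), ad u (by omega)]
        · simp [hw_def, ac u (by omega), ad u (by omega), ac v (by omega), ad v (by omega), hp']
      rw [key]
  rw [e₁, lift]
  generalize reversed w = g at e₂
  rw [hw_def]
  simp only [erase_append, erase_cross_cons, erase_nil, erase_ordered, twist_dual, e₂]
  exact .second ..

theorem lift_third {u v x y : Word} {a b c : ℕ} {p₁ p₂ p₃ : Passage} {s₁ s₂ s₃ e₁ e₂ e₃ : Bool}
    (hp : TriangleTypes p₁ p₂ p₃) (h₁₂ : (e₃ ^^ s₁) = (e₂ ^^ s₂)) (h₂₃ : (e₂ ^^ s₂) = (e₁ ^^ s₃))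
    {w w' : Word}
    (hw_def : w = u ++ ordered e₁ (.cross a p₁ s₁) (.cross b p₂ s₂) ++ v ++
      ordered e₂ (.cross a p₁.dual (!s₁)) (.cross c p₃ s₃) ++ x ++
      ordered e₃ (.cross b p₂.dual (!s₂)) (.cross c p₃.dual (!s₃)) ++ y)
    (hw_def' : w' = u ++ ordered (!e₁) (.cross a p₁ s₁) (.cross b p₂ s₂) ++ v ++
      ordered (!e₂) (.cross a p₁.dual (!s₁)) (.cross c p₃ s₃) ++ x ++
      ordered (!e₃) (.cross b p₂.dual (!s₂)) (.cross c p₃.dual (!s₃)) ++ y)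
    (hw : WellFormed w) : BasicMove (lift w) (lift w') := by
  have e : reversed w' = reversed w := funext fun d =>
    reversed_congr 0 fun q _ => by simp [hw_def, hw_def']
  have ha := hw.multiplicity_le a
  have hb := hw.multiplicity_le b
  have hc := hw.multiplicity_le c
  simp [hw_def] at ha hb hc
  have hab : a ≠ b := by rintro rfl; simp at ha; split_ifs at ha <;> omega
  have hac : a ≠ c := by rintro rfl; simp at ha; split_ifs at ha <;> omega
  have hbc : b ≠ c := by rintro rfl; simp at hb; split_ifs at hb <;> omega
  simp [hab, hac, hbc, hab.symm, hac.symm, hbc.symm] at ha hb hc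
  have aa := fun y h q => avoids_of_multiplicity (w := y) (c := a) h q
  have ab := fun y h q => avoids_of_multiplicity (w := y) (c := b) h q
  have ac := fun y h q => avoids_of_multiplicity (w := y) (c := c) h q
  have hd : ∀ p : Passage, p ≠ .virt → p ≠ p.dual := fun p => by cases p <;> simp [Passage.dual]
  have hp' : TriangleTypes (twist (reversed w a) p₁) (twist (reversed w b) p₂)
      (twist (reversed w c) p₃) := by
    refine hp.twist (i := weight u) (j := weight u + weight v)
      (k := weight u + weight v + weight x) (fun h => reversed_eq_of_level h ?_ ?_)
      (fun h => reversed_eq_of_level h ?_ ?_) (fun h => reversed_eq_of_level h ?_ ?_) <;>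
    simp [hw_def, hab, hac, hbc, hab.symm, hac.symm, hbc.symm, hd _ h, aa u (by omega),
      aa v (by omega), ab u (by omega), ab v (by omega), ab x (by omega), ac u (by omega),
      ac v (by omega), ac x (by omega), add_assoc]
  rw [lift, lift, e]
  generalize reversed w = g at hp'
  rw [hw_def, hw_def']
  simp only [erase_append, erase_ordered, twist_dual]
  exact .third _ _ _ _ _ _ _ _ _ _ _ _ _ _ _ _ hp' h₁₂ h₂₃

theorem erase_map_switch (g : ℕ → Bool) (c : ℕ) (w : Word) :
    erase g (w.map (Token.switch c)) = erase (fun d => g d ^^ decide (d = c)) w := by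
  simp only [erase, List.filterMap_map]
  apply List.filterMap_congr
  rintro (⟨d, p, s⟩ | ε) _
  · by_cases h : d = c <;> cases hg : g d <;>
      simp [Token.switch, Token.erase?, h, hg, twist, dual_dual] <;> simp_all
  · rfl

theorem weight_map_switch (c : ℕ) (w : Word) : weight (w.map (Token.switch c)) = weight w := by
  induction w with
  | nil => rfl
  | cons t w ih => rcases t with ⟨d, p, s⟩ | ε <;> simp [Token.switch, ih]

theorem level_map_switch (c : ℕ) (w : Word) (d : ℕ) (p : Passage) :
    level (w.map (Token.switch c)) d p = level w d (twist (decide (d = c)) p) := by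
  induction w with
  | nil => rfl
  | cons t w ih =>
    rcases t with ⟨x, q, s⟩ | ε
    · simp only [List.map_cons, Token.switch, level_cross_cons, ih]
      by_cases hx : x = d
      · subst hx
        by_cases hd : x = c <;> simp [hd]
        cases p <;> cases q <;> simp [Passage.dual]
      · simp [hx]
    · simp [Token.switch, ih]

theorem avoids_map_switch (c : ℕ) (w : Word) (d : ℕ) (p : Passage) :
    Avoids (w.map (Token.switch c)) d p ↔ Avoids w d (twist (decide (d = c)) p) := by
  induction w with
  | nil => simp
  | cons t w ih =>
    rcases t with ⟨x, q, s⟩ | ε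
    · simp only [List.map_cons, Token.switch, avoids_cross_cons, ih]
      by_cases hx : x = d
      · subst hx
        by_cases hd : x = c <;> simp [hd]
        cases p <;> cases q <;> simp [Passage.dual]
      · simp [hx]
    · simp [Token.switch, ih]

/-- Moving a double line through a classical crossing does not change the lift. -/
theorem LineCrossingMove.lift_eq {w w' : Word} (h : LineCrossingMove w w') (hw : WellFormed w) :
    lift w = lift w' := by
  rcases h with ⟨u, v, c, s⟩ | ⟨u, v, c, s⟩
  all_goals
    rw [List.append_assoc, List.cons_append] at hw
    have ha := hw.avoids (by simp)
    simp only [List.cons_append, List.nil_append, avoids_line_cons] at ha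
    rw [lift, lift]
    set w := u ++ _ ++ v with hw_def
    set w' := u.map (Token.switch c) ++ _ ++ v.map (Token.switch c) with hw_def'
    have hg : ∀ d, reversed w' d = (reversed w d ^^ decide (d = c)) := by
      intro d
      by_cases hd : d = c
      · subst hd
        by_cases h₁ : Avoids u d .over <;> by_cases h₂ : Avoids u d .under <;>
        simp [hw_def, hw_def', reversed, level_map_switch, weight_map_switch, avoids_map_switch,
          Passage.dual, ha, h₁, h₂] <;> rw [← decide_not, decide_eq_decide] <;> omega
      · have hd' : c ≠ d := fun h => hd h.symm
        simp only [hd, decide_false, Bool.xor_false]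
        refine reversed_congr 0 fun q _ => ?_
        simp [hw_def, hw_def', level_map_switch, weight_map_switch, avoids_map_switch, hd, hd']
    have e : (fun d => reversed w' d ^^ decide (d = c)) = reversed w := by
      funext d; simp [hg]
    rw [hw_def, hw_def', erase_append, erase_append, erase_append, erase_append, ← hw_def,
      ← hw_def', erase_map_switch, erase_map_switch, e]
    simp [hg, twist, Passage.dual]
    try cases reversed w c <;> rfl

/-- The lifts of two diagrams related by a move are equal or related by one basic move. -/
theorem lift_move {w w' : Word} (h : BasicMove w w' ∨ LineCrossingMove w w')
    (hw : WellFormed w) (hw' : WellFormed w') (h₀ : weight w = 0) :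
    BasicMove (lift w) (lift w') ∨ lift w = lift w' := by
  rcases h with h | h
  · cases h with
    | rotate u v =>
      rw [lift_rotate hw h₀, lift, erase_append]
      exact .inl (.rotate ..)
    | rename f hf w =>
      rw [lift_rename hf]
      exact .inl (.rename f hf _)
    | first u v c p s => exact .inl (lift_first hw')
    | second u v x c d p s e => exact .inl (lift_second hw')
    | third u v x y a b c p₁ p₂ p₃ s₁ s₂ s₃ e₁ e₂ e₃ hp h₁₂ h₂₃ =>
      exact .inl (lift_third hp h₁₂ h₂₃ rfl rfl hw)
    | lineVirtual u v c s ε =>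
      right
      rw [lift, lift, erase_congr (g' := reversed (u ++ [.line ε, .cross c .virt s] ++ v))]
      · simp
      · refine fun d _ _ _ _ => reversed_congr 0 fun q hq => ?_
        simp [hq.symm]
    | lineCancel u v ε =>
      right
      rw [lift, lift, erase_congr (g' := reversed (u ++ v))]
      · simp
      · refine fun d _ _ _ _ => reversed_congr 0 fun q hq => ?_
        simp
  · exact .inr (h.lift_eq hw)

theorem weight_rename (f : ℕ → ℕ) (w : Word) : weight (w.map (Token.rename f)) = weight w := by
  induction w with
  | nil => rfl
  | cons t w ih => rcases t with ⟨d, p, s⟩ | ε <;> simp [Token.rename, ih]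

theorem weight_move {w w' : Word} (h : BasicMove w w' ∨ LineCrossingMove w w') :
    weight w = weight w' := by
  rcases h with h | h
  · cases h <;> simp [weight_rename, add_comm]
  · cases h <;> simp [weight_map_switch]

/-! ### Moving double lines -/

/-- In any context, `w` and `w'` are related by a basic move or a crossing sliding move which leaves
the crossings in place and changes double lines only. -/
def LineStep (w w' : Word) : Prop :=
  (∀ u v, BasicMove (u ++ w ++ v) (u ++ w' ++ v) ∨ SlidingMove (u ++ w ++ v) (u ++ w' ++ v)) ∧
    crossings w' = crossings w

/-- Equality up to moves of double lines, in any context. -/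
def LineEquiv : Word → Word → Prop := Relation.EqvGen LineStep

namespace LineEquiv

theorem refl (w : Word) : LineEquiv w w := Relation.EqvGen.refl w

theorem of_eq {w w' : Word} (h : w = w') : LineEquiv w w' := h ▸ refl w

theorem symm {w w' : Word} (h : LineEquiv w w') : LineEquiv w' w :=
  Relation.EqvGen.symm _ _ h

theorem trans {w₁ w₂ w₃ : Word} (h : LineEquiv w₁ w₂) (h' : LineEquiv w₂ w₃) :
    LineEquiv w₁ w₃ := Relation.EqvGen.trans _ _ _ h h'

theorem context {w w' : Word} (h : LineEquiv w w') (u v : Word) :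
    LineEquiv (u ++ w ++ v) (u ++ w' ++ v) := by
  induction h with
  | rel w w' h =>
    refine .rel _ _ ⟨fun x y => ?_, by simp [crossings, h.2]⟩
    simpa using h.1 (x ++ u) (v ++ y)
  | refl => exact .refl _
  | symm _ _ _ ih => exact ih.symm
  | trans _ _ _ _ _ ih ih' => exact ih.trans ih'

theorem append {w₁ w₁' w₂ w₂' : Word} (h₁ : LineEquiv w₁ w₁') (h₂ : LineEquiv w₂ w₂') :
    LineEquiv (w₁ ++ w₂) (w₁' ++ w₂') := by
  have a := h₁.context [] w₂
  have b := h₂.context w₁' []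
  rw [List.append_nil, List.append_nil] at b
  exact a.trans b

theorem line_cancel (ε : ℤˣ) : LineEquiv [.line ε, .line (-ε)] [] :=
  .rel _ _ ⟨fun u v => .inl (by simpa using BasicMove.lineCancel u v ε), rfl⟩

theorem line_virtual (c : ℕ) (s : Bool) (ε : ℤˣ) :
    LineEquiv [.cross c .virt s, .line ε] [.line ε, .cross c .virt s] :=
  .rel _ _ ⟨fun u v => .inl (.lineVirtual u v c s ε), rfl⟩

theorem line_slide (v : Word) (c : ℕ) (p : Passage) (hp : p ≠ .virt) (s : Bool) (ε : ℤˣ) :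
    LineEquiv ([.cross c p s] ++ v ++ [.cross c p.dual (!s)])
      ([.line ε, .cross c p s, .line (-ε)] ++ v ++
        [.line ε, .cross c p.dual (!s), .line (-ε)]) := by
  refine .rel _ _ ⟨fun u x => .inr ?_, by simp⟩
  simpa using SlidingMove.slide u v x c p hp s ε

/-- If a diagram is obtained from another one by moving double lines, then the two are equivalent
up to the crossing sliding move and the basic moves. -/
theorem slidingEquivalent {D D' : Diagram} (h : LineEquiv D.word D'.word) :
    SlidingEquivalent D D' := by
  refine (eqvGen_diagram (r := LineStep) (fun w w' h => isDiagram_iff _ h.2) (fun D D' h => ?_)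
    h).2 D D' rfl rfl
  simpa using h.1 [] []

end LineEquiv

/-- `|n|` double lines whose sign is the sign of `n`. -/
def lines (n : ℤ) : Word := List.replicate n.natAbs (.line (if 0 ≤ n then 1 else -1))

@[simp] theorem lines_zero : lines 0 = [] := rfl

@[simp] theorem weight_lines (n : ℤ) : weight (lines n) = n := by
  have h : ∀ (k : ℕ) (ε : ℤˣ), weight (List.replicate k (.line ε)) = k * ε := by
    intro k ε
    simp [weight, Token.weight]
  rw [lines, h]
  split_ifs with hn <;> simp only [Units.val_one, Units.val_neg] <;> omega

@[simp] theorem avoids_lines (n : ℤ) (c : ℕ) (p : Passage) : Avoids (lines n) c p := by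
  simp [avoids_iff, lines]

@[simp] theorem erase_lines (g : ℕ → Bool) (n : ℤ) : erase g (lines n) = [] := by
  simp [lines, erase, Token.erase?]

theorem lines_ofNat (n : ℕ) : lines n = List.replicate n (.line 1) := by
  simp [lines]

theorem lines_neg_ofNat (n : ℕ) : lines (-n) = List.replicate n (.line (-1)) := by
  cases n with
  | zero => rfl
  | succ n =>
    rw [lines, if_neg (by omega), Int.natAbs_neg, Int.natAbs_natCast]

theorem line_lines (ε : ℤˣ) (n : ℤ) : LineEquiv ([.line ε] ++ lines n) (lines (ε + n)) := by
  have pos : ∀ n : ℕ, [.line 1] ++ lines n = lines (1 + n) := fun n => by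
    rw [show (1 : ℤ) + n = ((n + 1 : ℕ) : ℤ) by push_cast; ring, lines_ofNat, lines_ofNat]
    rfl
  have neg : ∀ n : ℕ, [.line (-1)] ++ lines (-n) = lines (-1 + -n) := fun n => by
    rw [show (-1 : ℤ) + -n = -((n + 1 : ℕ) : ℤ) by push_cast; ring, lines_neg_ofNat,
      lines_neg_ofNat]
    rfl
  -- When the signs differ, the new line cancels the first one of `lines n`.
  have cancel : ∀ ε : ℤˣ, ∀ n m : ℤ, [.line (-ε)] ++ lines m = lines n →
      LineEquiv ([.line ε] ++ lines n) (lines m) := fun ε n m h => by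
    rw [← h]
    exact (LineEquiv.line_cancel ε).append (.refl (lines m))
  rcases Int.units_eq_one_or ε with rfl | rfl
  · rcases le_or_gt 0 n with hn | hn
    · lift n to ℕ using hn
      exact .of_eq (pos n)
    · obtain ⟨m, rfl⟩ : ∃ m : ℕ, n = -1 + -m := ⟨(-1 - n).toNat, by omega⟩
      have := cancel 1 _ _ (neg m)
      simpa using this
  · rcases le_or_gt n 0 with hn | hn
    · obtain ⟨m, rfl⟩ : ∃ m : ℕ, n = -m := ⟨(-n).toNat, by omega⟩
      exact .of_eq (neg m)
    · obtain ⟨m, rfl⟩ : ∃ m : ℕ, n = 1 + m := ⟨(n - 1).toNat, by omega⟩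
      have := cancel (-1) _ _ (by rw [neg_neg]; exact pos m)
      simpa using this

theorem lines_append (n m : ℤ) : LineEquiv (lines n ++ lines m) (lines (n + m)) := by
  have step : ∀ (k : ℕ) (ε : ℤˣ) (m : ℤ),
      LineEquiv (List.replicate k (.line ε) ++ lines m) (lines (k * ε + m)) := by
    intro k ε
    induction k with
    | zero => intro m; simpa using LineEquiv.refl _
    | succ k ih =>
      intro m
      have h := (LineEquiv.refl [.line ε]).append (ih m)
      refine (LineEquiv.of_eq ?_).trans (h.trans ((line_lines ε _).trans (.of_eq ?_)))
      · simp [List.replicate_succ]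
      · congr 1; push_cast; ring
  rw [lines]
  refine (step _ _ m).trans (.of_eq ?_)
  congr 2
  split_ifs <;> simp only [Units.val_one, Units.val_neg] <;> omega

theorem virtual_lines (c : ℕ) (s : Bool) (n : ℤ) :
    LineEquiv ([.cross c .virt s] ++ lines n) (lines n ++ [.cross c .virt s]) := by
  have h : ∀ (k : ℕ) (ε : ℤˣ), LineEquiv ([.cross c .virt s] ++ List.replicate k (.line ε))
      (List.replicate k (.line ε) ++ [.cross c .virt s]) := by
    intro k ε
    induction k with
    | zero => exact .refl _
    | succ k ih =>
      have h₁ := (LineEquiv.line_virtual c s ε).append (.refl (List.replicate k (.line ε)))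
      have h₂ := (LineEquiv.refl [.line ε]).append ih
      rw [List.replicate_succ]
      simpa using h₁.trans h₂
  exact h _ _

/-- The word `w` with the double lines `lines n` before and `lines (-n)` after it. -/
def conj (n : ℤ) (w : Word) : Word := lines n ++ w ++ lines (-n)

theorem conj_conj (n m : ℤ) (w : Word) : LineEquiv (conj n (conj m w)) (conj (n + m) w) := by
  have h := ((lines_append n m).append (.refl w)).append (lines_append (-m) (-n))
  have e : -m + -n = -(n + m) := by ring
  rw [e] at h
  simpa [conj] using h

theorem slide_one (ε : ℤˣ) (v : Word) (c : ℕ) {p : Passage} (hp : p ≠ .virt) (s : Bool) :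
    LineEquiv ([.cross c p s] ++ v ++ [.cross c p.dual (!s)])
      (conj ε [.cross c p s] ++ v ++ conj ε [.cross c p.dual (!s)]) := by
  have h : ∀ t : Token, conj ε [t] = [.line ε, t, .line (-ε)] := by
    rcases Int.units_eq_one_or ε with rfl | rfl <;> intro t <;> rfl
  rw [h, h]
  exact .line_slide v c p hp s ε

/-- The crossing sliding move, repeated: a crossing moves through several levels at once. -/
theorem slide (k : ℤ) (v : Word) (c : ℕ) {p : Passage} (hp : p ≠ .virt) (s : Bool) :
    LineEquiv ([.cross c p s] ++ v ++ [.cross c p.dual (!s)])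
      (conj k [.cross c p s] ++ v ++ conj k [.cross c p.dual (!s)]) := by
  have step : ∀ (k : ℤ) (ε : ℤˣ), LineEquiv ([.cross c p s] ++ v ++ [.cross c p.dual (!s)])
      (conj k [.cross c p s] ++ v ++ conj k [.cross c p.dual (!s)]) →
      LineEquiv ([.cross c p s] ++ v ++ [.cross c p.dual (!s)])
        (conj (k + ε) [.cross c p s] ++ v ++ conj (k + ε) [.cross c p.dual (!s)]) := by
    intro k ε h
    have h₁ := (slide_one ε (lines (-k) ++ v ++ lines k) c hp s).context (lines k) (lines (-k))
    have h₂ := ((conj_conj k ε [.cross c p s]).append (.refl v)).append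
      (conj_conj k ε [.cross c p.dual (!s)])
    refine h.trans ((LineEquiv.of_eq ?_).trans (h₁.trans ((LineEquiv.of_eq ?_).trans h₂))) <;>
      simp [conj]
  induction k using Int.induction_on with
  | zero => exact .of_eq (by simp [conj])
  | succ k ih => simpa using step k 1 ih
  | pred k ih => simpa [sub_eq_add_neg] using step (-k) (-1) ih

/-! ### Double lines around crossings -/

/-- The crossings of a word are switched as described by `g`, and `lines (a c p)` is put before the
(former) passage of type `p` through `c`, with the opposite double lines after it. -/
def decorateToken (a : ℕ → Passage → ℤ) (g : ℕ → Bool) : Token → Word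
  | .cross c p s => conj (a c p) [.cross c (twist (g c) p) s]
  | .line ε => [.line ε]

/-- Switch the crossings and put double lines around the passages of a word. -/
def decorate (a : ℕ → Passage → ℤ) (g : ℕ → Bool) (w : Word) : Word :=
  w.flatMap (decorateToken a g)

@[simp] theorem decorate_nil (a : ℕ → Passage → ℤ) (g : ℕ → Bool) : decorate a g [] = [] := rfl

@[simp] theorem decorate_append (a : ℕ → Passage → ℤ) (g : ℕ → Bool) (u v : Word) :
    decorate a g (u ++ v) = decorate a g u ++ decorate a g v := List.flatMap_append ..

@[simp] theorem decorate_cross_cons (a : ℕ → Passage → ℤ) (g : ℕ → Bool) (c : ℕ) (p : Passage)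
    (s : Bool) (v : Word) : decorate a g (.cross c p s :: v) =
      conj (a c p) [.cross c (twist (g c) p) s] ++ decorate a g v := rfl

@[simp] theorem decorate_line_cons (a : ℕ → Passage → ℤ) (g : ℕ → Bool) (ε : ℤˣ) (v : Word) :
    decorate a g (.line ε :: v) = .line ε :: decorate a g v := rfl

theorem decorate_congr {a a' : ℕ → Passage → ℤ} {g g' : ℕ → Bool} {w : Word}
    (h : ∀ c p s, .cross c p s ∈ w → a c p = a' c p ∧ (p ≠ .virt → g c = g' c)) :
    decorate a g w = decorate a' g' w := by
  apply List.flatMap_congr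
  rintro (⟨c, p, s⟩ | ε) ht
  · obtain ⟨h₁, h₂⟩ := h c p s ht
    rw [decorateToken, decorateToken, h₁]
    by_cases hp : p = .virt
    · simp [hp]
    · rw [h₂ hp]
  · rfl

theorem crossings_decorate (a : ℕ → Passage → ℤ) (g : ℕ → Bool) (w : Word) :
    crossings (decorate a g w) = erase g w := by
  induction w with
  | nil => rfl
  | cons t w ih => rcases t with ⟨c, p, s⟩ | ε <;> simp [conj, ih]

theorem exists_split {c : ℕ} {w : Word} {p q : Passage} {s t : Bool}
    (h : w.filterMap (Token.passage? c) = [(p, s), (q, t)]) :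
    ∃ x y z : Word, w = x ++ [.cross c p s] ++ y ++ [.cross c q t] ++ z ∧
      multiplicity c x = 0 ∧ multiplicity c y = 0 ∧ multiplicity c z = 0 := by
  have key : ∀ (t : Token) (p : Passage) (s : Bool), t.passage? c = some (p, s) →
      t = .cross c p s := by
    rintro (⟨d, q, r⟩ | ε) p s h
    · by_cases hd : d = c <;> simp [Token.passage?, hd] at h
      rw [hd, h.1, h.2]
    · cases h
  obtain ⟨x, a, w, rfl, hx, ha, h⟩ := List.filterMap_eq_cons_iff.1 h
  obtain ⟨y, b, z, rfl, hy, hb, hz⟩ := List.filterMap_eq_cons_iff.1 h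
  refine ⟨x, y, z, by simp [key _ _ _ ha, key _ _ _ hb], ?_, ?_, ?_⟩
  · simpa [multiplicity] using hx
  · simpa [multiplicity] using hy
  · simp [multiplicity, hz]

/-- The double lines around one crossing may be changed by a crossing sliding move. -/
theorem decorate_slide_one {w : Word} (hw : WellFormed w) {a a' : ℕ → Passage → ℤ}
    (g : ℕ → Bool) (c : ℕ) (h : ∀ d, d ≠ c → a d = a' d) (hv : a c .virt = a' c .virt)
    (hc : a c .over - a c .under = a' c .over - a' c .under) :
    LineEquiv (decorate a g w) (decorate a' g w) := by
  have congr : ∀ x, multiplicity c x = 0 → decorate a g x = decorate a' g x := by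
    refine fun x hx => decorate_congr fun d p s hd => ⟨?_, fun _ => rfl⟩
    rw [h d]
    rintro rfl
    exact absurd (multiplicity_pos hd) (by omega)
  rcases hw c with h₀ | ⟨p, s, h₂⟩
  · exact .of_eq (congr w (by simp [multiplicity, h₀]))
  · obtain ⟨x, y, z, rfl, hx, hy, hz⟩ := exists_split h₂
    simp only [decorate_append, decorate_cross_cons, decorate_nil, List.append_nil, congr x hx,
      congr y hy, congr z hz]
    by_cases hp : p = .virt
    · subst hp
      simpa [Passage.dual, hv] using LineEquiv.refl _
    · -- The two passages need the same number `k` of additional double lines.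
      obtain ⟨k, hk, hk'⟩ : ∃ k, a' c p = a c p + k ∧ a' c p.dual = a c p.dual + k := by
        refine ⟨a' c p - a c p, by ring, ?_⟩
        cases p <;> simp [Passage.dual] at hp ⊢ <;> omega
      have hq : twist (g c) p ≠ .virt := by simpa
      rw [twist_dual, hk, hk']
      generalize twist (g c) p = q at hq
      generalize a c p = m
      generalize a c p.dual = n
      generalize decorate a' g x = x
      generalize decorate a' g y = y
      generalize decorate a' g z = z
      have h₁ := (slide k (lines (-m) ++ y ++ lines n) c hq s).context (x ++ lines m)
        (lines (-n) ++ z)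
      have h₃ := ((conj_conj m k [.cross c q s]).append (.refl y)).append
        (conj_conj n k [.cross c q.dual (!s)])
      refine ((LineEquiv.of_eq ?_).trans h₁).trans
        (((LineEquiv.of_eq ?_).trans (h₃.context x z)).trans (.of_eq ?_)) <;> simp [conj]

theorem exists_label_bound (w : Word) : ∃ N, ∀ c p s, Token.cross c p s ∈ w → c < N := by
  induction w with
  | nil => exact ⟨0, by simp⟩
  | cons t w ih =>
    obtain ⟨N, hN⟩ := ih
    rcases t with ⟨d, q, r⟩ | ε
    · refine ⟨max N (d + 1), fun c p s h => ?_⟩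
      rcases List.mem_cons.1 h with h | h
      · cases h; omega
      · have := hN c p s h; omega
    · exact ⟨N, fun c p s h => hN c p s (by simpa using h)⟩

/-- Up to moves of double lines, only the difference between the double lines around the two
passages of a crossing matters. -/
theorem decorate_slide {w : Word} (hw : WellFormed w) {a a' : ℕ → Passage → ℤ} (g : ℕ → Bool)
    (hv : ∀ c, a c .virt = a' c .virt)
    (h : ∀ c, a c .over - a c .under = a' c .over - a' c .under) :
    LineEquiv (decorate a g w) (decorate a' g w) := by
  have key : ∀ N : ℕ,
      LineEquiv (decorate a g w) (decorate (fun c => if c < N then a' c else a c) g w) := by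
    intro N
    induction N with
    | zero => exact .of_eq (by simp)
    | succ N ih =>
      refine ih.trans (decorate_slide_one hw g N (fun d hd => ?_) ?_ ?_)
      · simp only [show d < N + 1 ↔ d < N by omega]
      · simp [hv]
      · simp [h]
  obtain ⟨N, hN⟩ := exists_label_bound w
  refine (key N).trans (.of_eq (decorate_congr fun c p s hc => ⟨?_, fun _ => rfl⟩))
  rw [if_pos (hN c p s hc)]

/-- Every classical passage brought back to the level `0`. -/
def descent (w : Word) (c : ℕ) : Passage → ℤ
  | .virt => 0
  | p => -level w c p

/-- When every classical passage is brought to the level `0`, all double lines of a diagram of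
degree `0` cancel. -/
theorem decorate_descent {w : Word} (hw : WellFormed w) (h₀ : weight w = 0) (g : ℕ → Bool) :
    LineEquiv (decorate (descent w) g w) (erase g w) := by
  have key : ∀ v u : Word, w = u ++ v →
      LineEquiv (decorate (descent w) g v) (lines (-weight u) ++ erase g v) := by
    intro v
    induction v with
    | nil =>
      rintro u rfl
      rw [List.append_nil] at h₀
      rw [h₀]
      exact .refl _
    | cons t v ih =>
      rintro u rfl
      rcases t with ⟨c, p, s⟩ | ε
      · have ih := ih (u ++ [.cross c p s]) (by simp)
        simp only [weight_append, weight_cross_cons, weight_nil, add_zero] at ih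
        rw [decorate_cross_cons, erase_cross_cons]
        refine ((LineEquiv.refl _).append ih).trans ?_
        generalize erase g v = e
        by_cases hp : p = .virt
        · subst hp
          have := (virtual_lines c s (-weight u)).append (.refl e)
          simpa [descent, conj] using this
        · have ha := hw.avoids hp
          have hl : descent (u ++ .cross c p s :: v) c p = -weight u := by
            cases p <;> simp [descent, ha] at hp ⊢
          rw [hl, conj]
          have h₁ := lines_append (- -weight u) (-weight u)
          have h₂ := h₁.context (lines (-weight u) ++ [.cross c (twist (g c) p) s]) e
          rw [neg_add_cancel] at h₂
          simpa only [List.append_assoc, lines_zero, List.nil_append, List.cons_append] using h₂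
      · have ih := ih (u ++ [.line ε]) (by simp)
        have h₁ := (line_lines ε (-weight (u ++ [.line ε]))).append (.refl (erase g v))
        have e : (ε : ℤ) + -weight (u ++ [.line ε]) = -weight u := by simp
        rw [e] at h₁
        have h₂ := (LineEquiv.refl [.line ε]).append ih
        simpa using h₂.trans (by simpa using h₁)
  simpa using key w [] rfl

/-! ### The winding parity projection -/

/-- The double lines added by the winding parity projection. -/
def projectLines (w : Word) (c : ℕ) : Passage → ℤ
  | .over => if windingParity w c < 0 then -windingParity w c else 0
  | .under => if windingParity w c < 0 then 0 else windingParity w c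
  | .virt => 0

theorem projectWord_eq (w : Word) :
    projectWord w = decorate (projectLines w) (fun c => decide (windingParity w c < 0)) w := by
  apply List.flatMap_congr
  rintro (⟨c, p, s⟩ | ε) _
  · have e : ∀ n : ℤ, 0 ≤ n → ∀ t, conj n [t] =
        List.replicate n.natAbs (.line 1) ++ [t] ++ List.replicate n.natAbs (.line (-1)) := by
      intro n hn t
      lift n to ℕ using hn
      rw [conj, lines_ofNat, lines_neg_ofNat]
      rfl
    by_cases h : windingParity w c < 0
    · cases p <;> simp [projectToken, projectPassage, decorateToken, projectLines, h, Passage.dual,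
        e (-windingParity w c) (by omega), e 0 le_rfl]
    · cases p <;> simp [projectToken, projectPassage, decorateToken, projectLines, h,
        e (windingParity w c) (by omega), e 0 le_rfl]
  · rfl

theorem WellFormed.windingParity_eq {w : Word} (hw : WellFormed w) (h₀ : weight w = 0) {c : ℕ}
    {p : Passage} {s : Bool} (hc : .cross c p s ∈ w) (hp : p ≠ .virt) :
    windingParity w c = level w c .over - level w c .under := by
  obtain ⟨r, hr⟩ := hw.exists_mem hc
  cases p
  · exact DoubleLine.windingParity_eq hw h₀ hc hr
  · exact DoubleLine.windingParity_eq hw h₀ hr hc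
  · exact absurd rfl hp

/-- Up to the crossing sliding move the winding parity projection is the lift to `S_g × ℝ`. -/
theorem projectWord_lineEquiv {w : Word} (hw : WellFormed w) (h₀ : weight w = 0) :
    LineEquiv (projectWord w) (lift w) := by
  set g : ℕ → Bool := fun c => decide (level w c .over - level w c .under < 0) with hg
  let a : ℕ → Passage → ℤ := fun c p => match p with
    | .over => if level w c .over - level w c .under < 0 then
        -(level w c .over - level w c .under) else 0
    | .under => if level w c .over - level w c .under < 0 then 0
        else level w c .over - level w c .under
    | .virt => 0
  have e₁ : projectWord w = decorate a g w := by
    rw [projectWord_eq]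
    refine decorate_congr fun c p s hc => ⟨?_, fun hp => ?_⟩
    · by_cases hp : p = .virt
      · subst hp; rfl
      · cases p <;> simp only [projectLines, a, hw.windingParity_eq h₀ hc hp]
    · simp only [hg, hw.windingParity_eq h₀ hc hp]
  have e₂ : lift w = erase g w := by
    refine erase_congr fun c p s _ _ => ?_
    rw [hg, reversed]
    exact decide_eq_decide.2 (by omega)
  rw [e₁, e₂]
  refine (decorate_slide (a := a) (a' := descent w) hw g (fun _ => rfl) fun c => ?_).trans
    (decorate_descent hw h₀ g)
  simp only [a, descent]
  split_ifs <;> ring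

theorem level_conj_append {n : ℤ} {d c : ℕ} {q p : Passage} {s : Bool} {v : Word} :
    level (conj n [.cross d q s] ++ v) c p = if d = c ∧ q = p then n else level v c p := by
  simp only [conj, level_append, avoids_append, avoids_lines, avoids_cross_cons, avoids_nil,
    level_cross_cons, weight_append, weight_lines, weight_cross_cons, weight_nil]
  by_cases h : d = c ∧ q = p <;> simp [h]

theorem level_decorate (a : ℕ → Passage → ℤ) (g : ℕ → Bool) {w : Word} {c : ℕ} {p : Passage}
    {s : Bool} (h : .cross c p s ∈ w) :
    level (decorate a g w) c (twist (g c) p) = level w c p + a c p := by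
  induction w with
  | nil => simp at h
  | cons t w ih =>
    rcases t with ⟨d, q, r⟩ | ε
    · rw [decorate_cross_cons, level_conj_append, level_cross_cons]
      by_cases hd : d = c
      · subst hd
        have hi : twist (g d) q = twist (g d) p ↔ q = p :=
          ⟨fun h => by rw [← twist_twist (g d) q, h, twist_twist], fun h => h ▸ rfl⟩
        by_cases hq : q = p
        · simp [hq]
        · have hm : .cross d p s ∈ w := by
            rcases List.mem_cons.1 h with h | h
            · cases h; exact absurd rfl hq
            · exact h
          simp [hi, hq, ih hm]
      · have hm : .cross c p s ∈ w := by
          rcases List.mem_cons.1 h with h | h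
          · cases h; exact absurd rfl hd
          · exact h
        simp [hd, ih hm]
    · have hm : .cross c p s ∈ w := by simpa using h
      simp [ih hm, add_assoc]

theorem windingParity_projectWord {w : Word} (hw : WellFormed w) (h₀ : weight w = 0) {c : ℕ}
    {p : Passage} {s : Bool} (hc : .cross c p s ∈ projectWord w) (hp : p ≠ .virt) :
    windingParity (projectWord w) c = 0 := by
  have hw' := wellFormed_projectWord w hw
  have h₀' : weight (projectWord w) = 0 := (weight_projectWord w).trans h₀
  rw [hw'.windingParity_eq h₀' hc hp]
  obtain ⟨r₁, r₂, h₁, h₂⟩ : ∃ r₁ r₂, Token.cross c .over r₁ ∈ w ∧ Token.cross c .under r₂ ∈ w := by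
    obtain ⟨q, hq⟩ : ∃ q, .cross c (twist q p) s ∈ w := by
      have h : .cross c p s ∈ crossings (projectWord w) := mem_erase (fun _ => false) hc
      rw [projectWord_eq, crossings_decorate] at h
      exact ⟨_, mem_of_mem_erase h⟩
    obtain ⟨r, hr⟩ := hw.exists_mem hq
    have hq' : twist q p ≠ .virt := by simpa
    generalize twist q p = p' at hq hr hq'
    cases p'
    · exact ⟨_, _, hq, hr⟩
    · exact ⟨_, _, hr, hq⟩
    · exact absurd rfl hq'
  have l₁ := level_decorate (projectLines w) (fun c => decide (windingParity w c < 0)) h₁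
  have l₂ := level_decorate (projectLines w) (fun c => decide (windingParity w c < 0)) h₂
  rw [← projectWord_eq] at l₁ l₂
  have hi := hw.windingParity_eq h₀ h₁ (by simp)
  by_cases h : windingParity w c < 0
  · simp [h, projectLines, Passage.dual] at l₁ l₂
    omega
  · simp [h, projectLines] at l₁ l₂
    omega

/-- All winding parities vanish after the projection, so that projecting again changes nothing. -/
theorem projectWord_projectWord {w : Word} (hw : WellFormed w) (h₀ : weight w = 0) :
    projectWord (projectWord w) = projectWord w := by
  conv_rhs => rw [← List.flatMap_singleton' (projectWord w)]
  apply List.flatMap_congr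
  rintro (⟨c, p, s⟩ | ε) ht
  · by_cases hp : p = .virt
    · subst hp
      simp [projectToken, projectPassage, Passage.dual]
    · simp [projectToken, projectPassage, windingParity_projectWord hw h₀ ht hp]
  · rfl

/-! ### The crossing sliding move as an isotopy -/

theorem map_switch_eq {c : ℕ} {w : Word} (h : multiplicity c w = 0) :
    w.map (Token.switch c) = w := by
  conv_rhs => rw [← List.map_id w]
  apply List.map_congr_left
  rintro (⟨d, p, s⟩ | ε) ht
  · have hd : d ≠ c := by
      rintro rfl
      exact absurd (multiplicity_pos ht) (by omega)
    simp [Token.switch, hd]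
  · rfl

/-- A step between words which is a move other than the crossing sliding move, and after which the
crossings are the same up to over/under information. -/
def CurveStep (w w' : Word) : Prop :=
  (BasicMove w w' ∨ LineCrossingMove w w') ∧ ∃ g, crossings w' = erase g w

theorem CurveStep.equivalent {D D' : Diagram} (h : Relation.EqvGen CurveStep D.word D'.word) :
    Equivalent D D' :=
  (eqvGen_diagram (fun _ _ h => h.2.elim isDiagram_iff) (fun _ _ h => h.1) h).2 D D' rfl rfl

theorem curveStep_cancel (u v : Word) (ε : ℤˣ) :
    CurveStep (u ++ [.line ε, .line (-ε)] ++ v) (u ++ v) :=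
  ⟨.inl (.lineCancel u v ε), fun _ => false, by simp⟩

theorem curveStep_cross {w w' : Word} (h : LineCrossingMove w w') : CurveStep w w' := by
  refine ⟨.inr h, ?_⟩
  rcases h with ⟨u, v, c, s⟩ | ⟨u, v, c, s⟩ <;>
  exact ⟨fun d => decide (d = c), by simp [erase_map_switch, Passage.dual]⟩

/-- A strand moves through the level `S_g × {x₀}` next to a crossing, and the crossing is
changed. -/
theorem pass_strand {u v : Word} {c : ℕ} {p : Passage} (hp : p ≠ .virt) (s : Bool) {ε : ℤˣ}
    (hε : ε = if p = .over then 1 else -1) :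
    Relation.EqvGen CurveStep (u ++ [.cross c p s] ++ v)
      (u.map (Token.switch c) ++ [.line ε, .cross c p.dual s, .line (-ε)] ++
        v.map (Token.switch c)) := by
  have h₁ := curveStep_cancel (u ++ [.cross c p s]) v ε
  refine .trans _ _ _ (.symm _ _ (.rel _ _ h₁)) (.rel _ _ (curveStep_cross ?_))
  cases p
  · subst hε
    simpa [Token.switch, Passage.dual] using
      LineCrossingMove.positive u (.line (-1) :: v) c s
  · subst hε
    simpa [Token.switch, Passage.dual] using
      LineCrossingMove.negative u (.line 1 :: v) c s
  · exact absurd rfl hp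

/-- The crossing sliding move: the two strands of the crossing move through the level
`S_g × {x₀}` one after the other. -/
theorem SlidingMove.eqvGen {w w' : Word} (h : SlidingMove w w') (hw : WellFormed w) :
    Relation.EqvGen CurveStep w w' := by
  obtain ⟨u, v, x, c, p, hp, s, ε⟩ := h
  have hm := hw.multiplicity_le c
  simp at hm
  have hu := map_switch_eq (c := c) (w := u) (by omega)
  have hv := map_switch_eq (c := c) (w := v) (by omega)
  have hx := map_switch_eq (c := c) (w := x) (by omega)
  have hp' : p.dual ≠ .virt := by simpa
  by_cases hε : ε = if p = .over then 1 else -1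
  · have h₁ := pass_strand (u := u) (v := v ++ [.cross c p.dual (!s)] ++ x) (c := c) hp s hε
    have h₂ := pass_strand (u := u ++ [.line ε, .cross c p.dual s, .line (-ε)] ++ v) (v := x)
      (c := c) (p := p) hp (!s) hε
    refine .trans _ (u ++ [.line ε, .cross c p.dual s, .line (-ε)] ++ v ++
      [.cross c p (!s)] ++ x) _ ?_ ?_
    · simpa [Token.switch, hu, hv, hx, dual_dual] using h₁
    · simpa [Token.switch, hu, hv, hx, dual_dual] using h₂
  · have hε' : ε = if p.dual = .over then 1 else -1 := by
      revert hε
      rcases Int.units_eq_one_or ε with rfl | rfl <;> cases p <;> simp [Passage.dual] at hp ⊢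
    have h₁ := pass_strand (u := u ++ [.cross c p s] ++ v) (v := x) (c := c) hp' (!s) hε'
    have h₂ := pass_strand (u := u) (v := v ++ [.line ε, .cross c p (!s), .line (-ε)] ++ x)
      (c := c) hp' s hε'
    refine .trans _ (u ++ [.cross c p.dual s] ++ v ++
      [.line ε, .cross c p (!s), .line (-ε)] ++ x) _ ?_ ?_
    · simpa [Token.switch, hu, hv, hx, dual_dual] using h₁
    · simpa [Token.switch, hu, hv, hx, dual_dual] using h₂

theorem SlidingEquivalent.equivalent {D D' : Diagram} (h : SlidingEquivalent D D') :
    Equivalent D D' := by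
  induction h with
  | rel D D' h =>
    rcases h with h | h
    · exact .rel _ _ (.inl h)
    · exact CurveStep.equivalent (h.eqvGen D.wellFormed)
  | refl => exact .refl _
  | symm _ _ _ ih => exact .symm _ _ ih
  | trans _ _ _ _ _ ih ih' => exact .trans _ _ _ ih ih'

/-! ### The projection on classes -/

theorem prWP_slidingEquivalent_lift (D : DiagramZero) :
    SlidingEquivalent (prWP D).1 D.1.lift :=
  (projectWord_lineEquiv D.1.wellFormed D.2).slidingEquivalent

/-- The lifts of equivalent diagrams of degree `0` are related by basic moves; the
statement is in terms of the coarser sliding equivalence. -/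
theorem Equivalent.lift {D D' : Diagram} (h : Equivalent D D') :
    D.degree = D'.degree ∧ (D.degree = 0 → SlidingEquivalent D.lift D'.lift) := by
  induction h with
  | rel D D' h =>
    refine ⟨weight_move h, fun h₀ => ?_⟩
    rcases lift_move h D.wellFormed D'.wellFormed h₀ with h | h
    · exact .rel _ _ (.inl h)
    · exact (LineEquiv.of_eq h).slidingEquivalent
  | refl => exact ⟨rfl, fun _ => .refl _⟩
  | symm D D' _ ih => exact ⟨ih.1.symm, fun h₀ => .symm _ _ (ih.2 (ih.1.trans h₀))⟩
  | trans D₁ D₂ D₃ _ _ ih ih' =>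
    exact ⟨ih.1.trans ih'.1, fun h₀ => .trans _ _ _ (ih.2 h₀) (ih'.2 (ih.1.symm.trans h₀))⟩

theorem Equivalent.prWP {D₁ D₂ : DiagramZero} (h : Equivalent D₁.1 D₂.1) :
    SlidingEquivalent (prWP D₁).1 (prWP D₂).1 :=
  .trans _ _ _ (prWP_slidingEquivalent_lift D₁)
    (.trans _ _ _ (h.lift.2 D₁.2) (.symm _ _ (prWP_slidingEquivalent_lift D₂)))

theorem prWP_prWP (D : DiagramZero) : prWP (prWP D) = prWP D := by
  have ext : ∀ D D' : Diagram, D.word = D'.word → D = D' := by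
    rintro ⟨w, _, _⟩ ⟨w', _, _⟩ h
    obtain rfl : w = w' := h
    rfl
  exact Subtype.ext (ext _ _ (projectWord_projectWord D.1.wellFormed D.2))

end DoubleLine

theorem mainTheorem2 :
    (∃ F : DoubleLine.ClassZero → DoubleLine.ClassZero,
      (∀ D : DoubleLine.DiagramZero,
        F (DoubleLine.classOf D) = DoubleLine.classOf (DoubleLine.prWP D)) ∧
      F ∘ F = F) ∧
    (∀ D₁ D₂ : DoubleLine.DiagramZero, DoubleLine.Equivalent D₁.1 D₂.1 →
      DoubleLine.SlidingEquivalent (DoubleLine.prWP D₁).1 (DoubleLine.prWP D₂).1) ∧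
    (∀ D : DoubleLine.DiagramZero,
      DoubleLine.prWP (DoubleLine.prWP D) = DoubleLine.prWP D) := by
  refine ⟨⟨Quotient.lift (fun D => DoubleLine.classOf (DoubleLine.prWP D)) ?_, fun _ => rfl, ?_⟩,
    fun _ _ h => h.prWP, DoubleLine.prWP_prWP⟩
  · intro D₁ D₂ h
    exact Quotient.sound (DoubleLine.SlidingEquivalent.equivalent (DoubleLine.Equivalent.prWP h))
  · funext x
    induction x using Quotient.inductionOn with
    | h D => exact congrArg DoubleLine.classOf (DoubleLine.prWP_prWP D)
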